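/- Let $\mathsf{k}$ be an infinite field. An AG (Artinian Gorenstein) algebra is a local quotient $A=\mathsf{k}\{x_1,\dots,x_n\}/I$ ($n\ge 0$) of a power series ring, with maximal ideal $\mathfrak m$, $A/\mathfrak m=\mathsf{k}$, $\dim_{\mathsf k}A<\infty$ and $\dim_{\mathsf{k}}(0:\mathfrak m)=1$; its Hilbert function is $H(A)_i=\dim_{\mathsf{k}}\mathfrak m^i/\mathfrak m^{i+1}$ and its socle degree $j(A)$ is the largest $i$ with $\mathfrak m^i\neq 0$. In the associated graded algebra $A^*=\bigoplus_i \mathfrak m^i/\mathfrak m^{i+1}$ let $C_A(a)$ be the ideal whose degree-$i$ piece is the image of $\mathfrak m^i\cap(0:\mathfrak m^{\,j(A)+1-a-i})$ (where $\mathfrak m^b=A$ for $b\le 0$), and put $Q_A(a)=C_A(a)/C_A(a+1)$ and $H_A(a)_i=\dim_{\mathsf{k}}Q_A(a)_i$. The sequence $\mathcal D(A)=(H_A(0),H_A(1),H_A(2),\dots)$ is the symmetric decomposition of $H(A)$. A sequence $\mathcal D$ is realizable if $\mathcal D=\mathcal D(A)$ for some AG algebra $A$; a sequence is a Gorenstein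 sequence if it is $H(A)$ for some AG algebra $A$. Let $H(0)=(h_0,\dots,h_j)$, $h_j\ne 0$, be a symmetric Gorenstein sequence ($h_i=h_{j-i}$) of socle degree $j$, and put $r=h_1$. Suppose that for every homogeneous ideal $I\subset \mathsf{k}[x_1,\dots,x_r]$ such that $\mathsf{k}[x_1,\dots,x_r]/I$ is a (graded) Artinian Gorenstein algebra with Hilbert function $H(0)$, the ideal $I$ is generated by forms of degree at most $j-3$. Let $H(1)=(0,1,0,\dots,0,1_{j-2},0)$, the sequence with entries $1$ in degrees $1$ and $j-2$ and $0$ in all other degrees. Then 1. $(H(0),H(1))$ is not realizable as a complete symmetric decomposition: there is no AG algebra $A$ with $H_A(0)=H(0)$, $H_A(1)=H(1)$ and $H_A(a)=0$ for all $a\ge 2$; 2. $(H(0),H(1))$ is not the first part of a symmetric decomposition of any Gorenstein sequence: there is no realizable $\mathcal D=(\mathcal D(0),\mathcal D(1),\mathcal D(2),\dots)$ with $\mathcal D(0)=H(0)$ and $\mathcal D(1)=H(1)$. -/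

import Mathlib

namespace SymDecomp

open IsLocalRing

section LocalRing

variable (A : Type*) [CommRing A] [IsLocalRing A]

/-- The socle degree of an Artinian local ring: the largest `j` with `𝔪^j ≠ 0`. -/
noncomputable def socleDegree : ℕ :=
  sSup {i : ℕ | maximalIdeal A ^ i ≠ ⊥}

/-- The degree-`i` piece of the ideal `C(a)` of the associated graded ring `A^*`: with `j` the socle
degree, the image of `𝔪^i ∩ (0 : 𝔪^(j+1-a-i))` in `𝔪^i / 𝔪^(i+1) ⊆ A / 𝔪^(i+1)`.
A negative exponent `b` means `𝔪^b = A`, as the truncated subtraction does. -/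
noncomputable def idealC (a i : ℕ) : Submodule A (A ⧸ maximalIdeal A ^ (i + 1)) :=
  Submodule.map (Submodule.mkQ (maximalIdeal A ^ (i + 1)))
    (maximalIdeal A ^ i ⊓ (maximalIdeal A ^ (socleDegree A + 1 - a - i)).annihilator)

theorem idealC_succ_le (a i : ℕ) : idealC A (a + 1) i ≤ idealC A a i := by
  have h : socleDegree A + 1 - (a + 1) - i ≤ socleDegree A + 1 - a - i := by omega
  exact Submodule.map_mono (inf_le_inf_left _
    (Submodule.annihilator_mono (Ideal.pow_le_pow_right h)))

end LocalRing

section LocalAlgebra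

variable (k A : Type*) [Field k] [CommRing A] [Algebra k A] [IsLocalRing A]

/-- A local `k`-algebra `(A, 𝔪)` with `A / 𝔪 = k` is Artinian Gorenstein (AG): it has finite
length, i.e. finite dimension over `k`, and its socle `(0 : 𝔪)` has dimension one. -/
structure IsArtinianGorenstein : Prop where
  finite : Module.Finite k A
  residue : Function.Bijective (algebraMap k (ResidueField A))
  socle : Module.finrank k ↥(maximalIdeal A).annihilator = 1

/-- The Hilbert function `H(A)_i = dim_k (𝔪^i / 𝔪^(i+1))`. -/
noncomputable def hilbertFunction (i : ℕ) : ℕ :=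
  Module.finrank k (↥(maximalIdeal A ^ i) ⧸
    (maximalIdeal A ^ (i + 1)).submoduleOf (maximalIdeal A ^ i))

/-- The symmetric decomposition `𝒟(A) = (H_A(0), H_A(1), …)` of the Hilbert function:
`H_A(a)_i = dim_k Q(a)_i`, where `Q(a)_i = C(a)_i / C(a+1)_i`. -/
noncomputable def symmetricDecomposition (a i : ℕ) : ℕ :=
  Module.finrank k (↥(idealC A a i) ⧸ (idealC A (a + 1) i).submoduleOf (idealC A a i))

end LocalAlgebra

section Realizability

variable (k : Type*) [Field k]

/-- `H` is a Gorenstein sequence over `k`: the Hilbert function of some AG local quotient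
of a power series ring `k{x₁, …, xₙ}`. -/
def IsGorensteinSequence (H : ℕ → ℕ) : Prop :=
  ∃ (n : ℕ) (I : Ideal (MvPowerSeries (Fin n) k)) (_ : IsLocalRing (MvPowerSeries (Fin n) k ⧸ I)),
    IsArtinianGorenstein k (MvPowerSeries (Fin n) k ⧸ I) ∧
      ∀ i, hilbertFunction k (MvPowerSeries (Fin n) k ⧸ I) i = H i

/-- `H` is a symmetric Gorenstein sequence over `k` of socle degree `j`:
`H = (h₀, …, h_j)` with `h_j ≠ 0` and `h_i = h_{j-i}`. -/
structure IsSymmetricGorensteinSequence (H : ℕ → ℕ) (j : ℕ) : Prop where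
  gorenstein : IsGorensteinSequence k H
  top_ne_zero : H j ≠ 0
  eq_zero_of_lt : ∀ i, j < i → H i = 0
  symm : ∀ i, i ≤ j → H i = H (j - i)

/-- `D = (D 0, D 1, …)` is realizable over `k`: it is the (complete) symmetric decomposition
of some AG local quotient of a power series ring `k{x₁, …, xₙ}`. -/
def IsRealizable (D : ℕ → ℕ → ℕ) : Prop :=
  ∃ (n : ℕ) (I : Ideal (MvPowerSeries (Fin n) k)) (_ : IsLocalRing (MvPowerSeries (Fin n) k ⧸ I)),
    IsArtinianGorenstein k (MvPowerSeries (Fin n) k ⧸ I) ∧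
      ∀ a i, symmetricDecomposition k (MvPowerSeries (Fin n) k ⧸ I) a i = D a i

end Realizability

section Graded

attribute [local instance] MvPolynomial.gradedAlgebra

variable {k : Type*} [Field k] {r : ℕ} (I : Ideal (MvPolynomial (Fin r) k))

/-- `k[x₁, …, x_r] / I` is a graded AG algebra. -/
def IsGradedAG : Prop :=
  I.IsHomogeneous (MvPolynomial.homogeneousSubmodule (Fin r) k) ∧
    ∃ _ : IsLocalRing (MvPolynomial (Fin r) k ⧸ I),
      IsArtinianGorenstein k (MvPolynomial (Fin r) k ⧸ I)

/-- The Hilbert function `dim_k (k[x₁, …, x_r] / I)_i` of a graded quotient. -/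
noncomputable def gradedHilbertFunction (i : ℕ) : ℕ :=
  Module.finrank k ↥((MvPolynomial.homogeneousSubmodule (Fin r) k i).map
    (Ideal.Quotient.mkₐ k I).toLinearMap)

/-- `I` is generated by homogeneous elements of degrees at most the integer `c`. -/
def IsGeneratedInDegreesLE (c : ℤ) : Prop :=
  I = Ideal.span {p | p ∈ I ∧ ∃ d : ℕ, (d : ℤ) ≤ c ∧ p.IsHomogeneous d}

end Graded

/-- The sequence `(0, 1, 0, …, 0, 1, 0)` with entries `1` in degrees `1` and `j - 2` only. -/
def spikes (j i : ℕ) : ℕ := if i = 1 ∨ i + 2 = j then 1 else 0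

/-- The sequence of sequences `(H₀, H₁)`, completed by zero sequences. -/
def pair (H₀ H₁ : ℕ → ℕ) : ℕ → ℕ → ℕ
  | 0 => H₀
  | 1 => H₁
  | _ => 0

end SymDecomp

namespace SymDecomp

open IsLocalRing MvPolynomial

attribute [local instance] MvPolynomial.gradedAlgebra

/-! ### Forms and their values on elements of an ideal. -/

section Polynomial

variable {σ k A : Type*} [Field k] [CommRing A] [Algebra k A]

/-! Let `A` be AG with `H_A(0) = H(0)`, socle degree `j`, maximal ideal `𝔪`. Lift a basis of
`Q(0)_1` to `x₁, …, x_r ∈ 𝔪`. Evaluating degree-`j` forms at `x` lands in the line `𝔪^j`; the forms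
annihilating this functional make up a homogeneous ideal `I` (`dualIdeal`) with quotient `Q(0)`, a
graded AG algebra with Hilbert function `H(0)` (`isGradedAG_dualIdeal`,
`gradedHilbertFunction_dualIdeal`). A form of degree `d` lies in `I` exactly when its value lies in
`piece A j d`, which represents `C(1)_d` (`mem_dualIdeal_iff`).

By hypothesis `I` is generated in degrees at most `j - 3`, so `C(1)_{j-2}` comes from `𝔪 ·
C(1)_{j-3}` (`piece_le_mul_piece`). If `j > 4`, then `H(1)_{j-3} = 0`, so `C(1)_{j-3} = C(2)_{j-3}`;
multiplying by `𝔪` gives `C(1)_{j-2} = C(2)_{j-2}`, against `H(1)_{j-2} = 1`. If `j ≤ 4`, then `I`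
is generated in degrees at most `1`, hence is zero; this forces `r = 0` and `j = 0`, leaving no room
for `H(1)_1 = 1`. -/

theorem homogeneousComponent_mul_of_isHomogeneous {p : MvPolynomial σ k} {d : ℕ}
    (hp : p.IsHomogeneous d) (q : MvPolynomial σ k) (n : ℕ) :
    homogeneousComponent n (q * p) = if d ≤ n then homogeneousComponent (n - d) q * p else 0 := by
  have h := DirectSum.coe_decompose_mul_of_right_mem (homogeneousSubmodule σ k) (a := q) n
    ((mem_homogeneousSubmodule d p).2 hp)
  have e (f : MvPolynomial σ k) (m : ℕ) :
      (DirectSum.decompose (homogeneousSubmodule σ k) f m : MvPolynomial σ k) =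
        homogeneousComponent m f := decomposition.decompose'_apply f m
  simpa only [e] using h

theorem aeval_mem_pow_of_isHomogeneous {x : σ → A} {J : Ideal A} (hx : ∀ i, x i ∈ J)
    {p : MvPolynomial σ k} {d : ℕ} (hp : p.IsHomogeneous d) : aeval x p ∈ J ^ d := by
  rw [aeval_def, eval₂_eq]
  refine Ideal.sum_mem _ fun m hm => Ideal.mul_mem_left _ _ ?_
  have hd : m.degree = d := by
    by_contra h
    exact mem_support_iff.1 hm (hp.coeff_eq_zero h)
  rw [← hd, Finsupp.degree_apply, ← Finset.prod_pow_eq_pow_sum]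
  exact Ideal.prod_mem_prod fun i _ => Ideal.pow_mem_pow (hx i) _

end Polynomial

/-! ### The ideals of `A` that represent the graded pieces of `C(a)`. -/

section Piece

variable (A : Type*) [CommRing A] [IsLocalRing A]

/-- The ideal `𝔪^i ∩ (0 : 𝔪^(b-i))`. -/
noncomputable def piece (b i : ℕ) : Ideal A :=
  maximalIdeal A ^ i ⊓ (maximalIdeal A ^ (b - i)).annihilator

variable {A}

theorem mem_piece {b i : ℕ} {u : A} :
    u ∈ piece A b i ↔ u ∈ maximalIdeal A ^ i ∧ ∀ v ∈ maximalIdeal A ^ (b - i), u * v = 0 := by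
  rw [piece, Submodule.mem_inf, Submodule.mem_annihilator]
  rfl

theorem mul_mem_piece {b d e : ℕ} {u v : A} (hu : u ∈ piece A b d) (hv : v ∈ maximalIdeal A ^ e) :
    u * v ∈ piece A b (d + e) := by
  rw [mem_piece] at hu ⊢
  refine ⟨pow_add (maximalIdeal A) d e ▸ Ideal.mul_mem_mul hu.1 hv, fun w hw => ?_⟩
  rw [mul_assoc]
  refine hu.2 _ (Ideal.pow_le_pow_right ?_ (pow_add (maximalIdeal A) e _ ▸ Ideal.mul_mem_mul hv hw))
  omega

theorem pow_le_piece {j : ℕ} (hj : maximalIdeal A ^ (j + 1) = ⊥) (i : ℕ) :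
    maximalIdeal A ^ (i + 1) ≤ piece A j i := fun u hu => by
  refine mem_piece.2 ⟨Ideal.pow_le_pow_right (Nat.le_succ i) hu, fun v hv => ?_⟩
  rw [← Ideal.mem_bot, ← hj]
  refine Ideal.pow_le_pow_right ?_ (pow_add (maximalIdeal A) (i + 1) _ ▸ Ideal.mul_mem_mul hu hv)
  omega

theorem idealC_eq (a i : ℕ) : idealC A a i =
    Submodule.map (Submodule.mkQ (maximalIdeal A ^ (i + 1))) (piece A (socleDegree A + 1 - a) i) :=
  rfl

end Piece

/-! ### The symmetric decomposition in terms of `piece`. -/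

section Decomposition

variable {k A : Type*} [Field k] [CommRing A] [Algebra k A] [IsLocalRing A]

theorem maximalIdeal_pow_eq_bot_iff [Module.Finite k A] (i : ℕ) :
    maximalIdeal A ^ i = ⊥ ↔ socleDegree A < i := by
  have : IsArtinianRing A := IsArtinianRing.of_finite k A
  obtain ⟨n, hn⟩ : IsNilpotent (maximalIdeal A) := by
    rw [← jacobson_eq_maximalIdeal ⊥ bot_ne_top]
    exact IsArtinianRing.isNilpotent_jacobson_bot
  have hb : BddAbove {i : ℕ | maximalIdeal A ^ i ≠ ⊥} := ⟨n, fun m hm => by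
    by_contra! h
    exact hm (le_bot_iff.1 ((Ideal.pow_le_pow_right h.le).trans hn.le))⟩
  have h0 : (0 : ℕ) ∈ {i : ℕ | maximalIdeal A ^ i ≠ ⊥} := by simp
  constructor
  · intro h
    by_contra! hi
    exact Nat.sSup_mem ⟨0, h0⟩ hb (le_bot_iff.1 ((Ideal.pow_le_pow_right hi).trans h.le))
  · intro h
    by_contra hi
    exact absurd (le_csSup hb hi) (not_le.2 h)

theorem symmetricDecomposition_eq_zero_iff [Module.Finite k A] (a i : ℕ) :
    symmetricDecomposition k A a i = 0 ↔ piece A (socleDegree A + 1 - a) i ≤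
      piece A (socleDegree A - a) i ⊔ maximalIdeal A ^ (i + 1) := by
  have : Module.Finite k ↥(idealC A a i) :=
    Module.Finite.of_injective ((idealC A a i).subtype.restrictScalars k) Subtype.val_injective
  have e : socleDegree A - a = socleDegree A + 1 - (a + 1) := by omega
  rw [symmetricDecomposition, Module.finrank_eq_zero_iff_of_free,
    Submodule.Quotient.subsingleton_iff, Submodule.submoduleOf_eq_top, idealC_eq, idealC_eq, Submodule.map_le_iff_le_comap,
    Submodule.comap_map_mkQ, e, sup_comm]

/-- Presents `Q(0)_i` as `𝔪^i` modulo `piece A j i`: since `𝔪^(j+1) = 0`, `C(0)_i` is everything and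
`𝔪^(i+1)` already lies in `piece A j i`. -/
theorem exists_surjective_symmetricDecomposition_zero [Module.Finite k A] (i : ℕ) :
    ∃ π : ↥(maximalIdeal A ^ i) →ₗ[k]
        (↥(idealC A 0 i) ⧸ (idealC A (0 + 1) i).submoduleOf (idealC A 0 i)),
      Function.Surjective π ∧ ∀ u, π u = 0 ↔ (u : A) ∈ piece A (socleDegree A) i := by
  have hj : maximalIdeal A ^ (socleDegree A + 1) = ⊥ :=
    (maximalIdeal_pow_eq_bot_iff (k := k) _).2 (Nat.lt_succ_self _)
  have h0 : piece A (socleDegree A + 1 - 0) i = maximalIdeal A ^ i := by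
    refine le_antisymm inf_le_left fun u hu => mem_piece.2 ⟨hu, fun v hv => ?_⟩
    rw [← Ideal.mem_bot, ← hj]
    refine Ideal.pow_le_pow_right ?_ (pow_add (maximalIdeal A) i _ ▸ Ideal.mul_mem_mul hu hv)
    omega
  have hm : ∀ u : ↥(maximalIdeal A ^ i),
      Submodule.mkQ (maximalIdeal A ^ (i + 1)) (u : A) ∈ idealC A 0 i := fun u => by
    rw [idealC_eq, h0]
    exact Submodule.mem_map_of_mem u.2
  let f : ↥(maximalIdeal A ^ i) →ₗ[A] ↥(idealC A 0 i) :=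
    ((Submodule.mkQ (maximalIdeal A ^ (i + 1))).comp (Submodule.subtype _)).codRestrict _ hm
  let g := Submodule.mkQ ((idealC A (0 + 1) i).submoduleOf (idealC A 0 i))
  refine ⟨(g.comp f).restrictScalars k, ?_, fun u => ?_⟩
  · refine (Submodule.mkQ_surjective _).comp ?_
    rintro ⟨y, hy⟩
    have hy' := hy
    rw [idealC_eq, h0] at hy'
    obtain ⟨u, hu, rfl⟩ := hy'
    exact ⟨⟨u, hu⟩, rfl⟩
  · have : ((g.comp f).restrictScalars k) u = 0 ↔
        Submodule.mkQ (maximalIdeal A ^ (i + 1)) (u : A) ∈ idealC A (0 + 1) i := by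
      simp only [g, LinearMap.coe_restrictScalars, LinearMap.comp_apply, Submodule.mkQ_apply,
        Submodule.Quotient.mk_eq_zero]
      rfl
    rw [this, idealC_eq, ← Submodule.mem_comap, Submodule.comap_map_mkQ, zero_add,
      Nat.add_sub_cancel, sup_eq_right.2 (pow_le_piece hj i)]

theorem finrank_eq_of_ker_eq {V W₁ W₂ : Type*} [AddCommGroup V] [Module k V] [AddCommGroup W₁]
    [Module k W₁] [AddCommGroup W₂] [Module k W₂] (f : V →ₗ[k] W₁) (g : V →ₗ[k] W₂)
    (h : LinearMap.ker f = LinearMap.ker g) :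
    Module.finrank k (LinearMap.range f) = Module.finrank k (LinearMap.range g) :=
  (f.quotKerEquivRange.symm.trans
    ((Submodule.quotEquivOfEq _ _ h).trans g.quotKerEquivRange)).finrank_eq

end Decomposition

/-! ### The dual ideal of the top-degree functional, and its Hilbert function. -/

section Coordinates

variable {k A : Type*} [Field k] [CommRing A] [Algebra k A] {r : ℕ}

variable (k) in
/-- The value at `x` of the degree-`j` component of a polynomial. -/
noncomputable def topValue (j : ℕ) (x : Fin r → A) : MvPolynomial (Fin r) k →ₗ[k] A :=
  (aeval x).toLinearMap.comp (homogeneousComponent j)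

variable (k) in
/-- The annihilator of the functional `topValue j x`. -/
noncomputable def dualIdeal (j : ℕ) (x : Fin r → A) : Ideal (MvPolynomial (Fin r) k) where
  carrier := {p | ∀ q, topValue k j x (q * p) = 0}
  add_mem' ha hb q := by rw [mul_add, map_add, ha, hb, add_zero]
  zero_mem' q := by rw [mul_zero, map_zero]
  smul_mem' c p hp q := by rw [smul_eq_mul, ← mul_assoc, hp]

theorem mem_dualIdeal {j : ℕ} {x : Fin r → A} {p : MvPolynomial (Fin r) k} :
    p ∈ dualIdeal k j x ↔ ∀ q, topValue k j x (q * p) = 0 := Iff.rfl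

theorem topValue_mul {j d : ℕ} {x : Fin r → A} {p : MvPolynomial (Fin r) k}
    (hp : p.IsHomogeneous d) (q : MvPolynomial (Fin r) k) :
    topValue k j x (q * p) =
      if d ≤ j then aeval x (homogeneousComponent (j - d) q) * aeval x p else 0 := by
  rw [topValue, LinearMap.comp_apply, homogeneousComponent_mul_of_isHomogeneous hp]
  split_ifs <;> simp

theorem mem_dualIdeal_of_lt {j d : ℕ} {x : Fin r → A} {p : MvPolynomial (Fin r) k}
    (hp : p.IsHomogeneous d) (hd : j < d) : p ∈ dualIdeal k j x := fun q => by
  rw [topValue_mul hp, if_neg (not_le.2 hd)]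

theorem homogeneousComponent_mem_dualIdeal {j : ℕ} {x : Fin r → A} {p : MvPolynomial (Fin r) k}
    (hp : p ∈ dualIdeal k j x) (d : ℕ) : homogeneousComponent d p ∈ dualIdeal k j x := by
  intro q
  rw [topValue_mul (homogeneousComponent_isHomogeneous d p)]
  split_ifs with h
  · have := hp (homogeneousComponent (j - d) q)
    rw [mul_comm, topValue_mul (homogeneousComponent_isHomogeneous _ q), if_pos (by omega),
      Nat.sub_sub_self h] at this
    rw [mul_comm, this]
  · rfl

theorem dualIdeal_isHomogeneous (j : ℕ) (x : Fin r → A) :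
    (dualIdeal k j x).IsHomogeneous (homogeneousSubmodule (Fin r) k) := by
  intro i p hp
  have e : (DirectSum.decompose (homogeneousSubmodule (Fin r) k) p i : MvPolynomial (Fin r) k) =
    homogeneousComponent i p := decomposition.decompose'_apply p i
  rw [e]
  exact homogeneousComponent_mem_dualIdeal hp i

/-- The `(j+1)`-st power of a form of positive degree has degree above `j`, where the dual ideal
contains everything. -/
theorem isNilpotent_mk_sub (j : ℕ) (x : Fin r → A) (p : MvPolynomial (Fin r) k) :
    IsNilpotent (Ideal.Quotient.mk (dualIdeal k j x) (p - C (coeff 0 p))) := by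
  have e : p - C (coeff 0 p) =
      ∑ i ∈ Finset.range p.totalDegree, homogeneousComponent (i + 1) p := by
    conv_lhs => rw [← sum_homogeneousComponent p, Finset.sum_range_succ']
    simp [coeff_sum, coeff_homogeneousComponent]
  rw [e, map_sum]
  refine isNilpotent_sum fun i _ => ⟨j + 1, ?_⟩
  rw [← map_pow, Ideal.Quotient.eq_zero_iff_mem]
  refine mem_dualIdeal_of_lt ((homogeneousComponent_isHomogeneous (i + 1) p).pow (j + 1)) ?_
  nlinarith [Nat.zero_le (i * (j + 1))]

theorem finite_quotient_dualIdeal (j : ℕ) (x : Fin r → A) :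
    Module.Finite k (MvPolynomial (Fin r) k ⧸ dualIdeal k j x) := by
  refine Module.Finite.of_surjective
    ((Ideal.Quotient.mkₐ k (dualIdeal k j x)).toLinearMap.comp
      (restrictTotalDegree (Fin r) k j).subtype) fun b => ?_
  obtain ⟨p, rfl⟩ := Ideal.Quotient.mk_surjective b
  refine ⟨⟨∑ i ∈ Finset.range (j + 1), homogeneousComponent i p,
    Submodule.sum_mem _ fun i hi => ?_⟩, ?_⟩
  · rw [mem_restrictTotalDegree]
    have := (homogeneousComponent_isHomogeneous i p).totalDegree_le
    have := Finset.mem_range.1 hi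
    omega
  · refine Ideal.Quotient.eq.2 ?_
    rw [mem_iff_homogeneousComponent_mem (dualIdeal_isHomogeneous j x)]
    intro n
    rcases le_or_gt n j with hn | hn
    · have : homogeneousComponent n
          (∑ i ∈ Finset.range (j + 1), homogeneousComponent i p - p) = 0 := by
        ext m
        simp only [coeff_homogeneousComponent, coeff_sub, coeff_sum, Finset.sum_ite_eq,
          Finset.mem_range, coeff_zero]
        split_ifs with h₁ h₂
        · exact sub_self _
        · omega
        · rfl
      exact this ▸ zero_mem _
    · exact mem_dualIdeal_of_lt (homogeneousComponent_isHomogeneous _ _) hn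

theorem mul_mem_dualIdeal {j : ℕ} {x : Fin r → A} {p q : MvPolynomial (Fin r) k}
    (hp : p.IsHomogeneous j) (hq : coeff 0 q = 0) : q * p ∈ dualIdeal k j x := by
  intro s
  rw [← mul_assoc, topValue_mul hp, if_pos le_rfl, Nat.sub_self, homogeneousComponent_zero]
  have : coeff 0 (s * q) = 0 := by
    rw [← constantCoeff_eq] at hq ⊢
    rw [map_mul, hq, mul_zero]
  simp [this]

section LocalRing

variable [IsLocalRing A]

/-- `x₁, …, x_r ∈ 𝔪` lift a basis of `𝔪 / (𝔪 ∩ (0 : 𝔪^(j-1)))`, where `A / 𝔪 = k` and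
`𝔪^(j+1) = 0`. -/
structure IsCoordinateSystem (k : Type*) {A : Type*} [Field k] [CommRing A] [Algebra k A]
    [IsLocalRing A] {r : ℕ} (j : ℕ) (x : Fin r → A) : Prop where
  pow_eq_bot : maximalIdeal A ^ (j + 1) = ⊥
  residue : ∀ a : A, ∃ c : k, a - algebraMap k A c ∈ maximalIdeal A
  mem : ∀ i, x i ∈ maximalIdeal A
  span : ∀ u ∈ maximalIdeal A, ∃ p : MvPolynomial (Fin r) k,
    p.IsHomogeneous 1 ∧ u - aeval x p ∈ piece A j 1
  indep : ∀ p : MvPolynomial (Fin r) k, p.IsHomogeneous 1 → aeval x p ∈ piece A j 1 → p = 0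

namespace IsCoordinateSystem

variable {j : ℕ} {x : Fin r → A} (hx : IsCoordinateSystem k j x)

include hx

/-- The product form of the error term is finer than membership in `piece A j (i + 1)`;
`piece_le_mul_piece` needs the factor `𝔪^i`. -/
theorem exists_aeval_sub_mem_mul (i : ℕ) : ∀ u ∈ maximalIdeal A ^ (i + 1),
    ∃ p : MvPolynomial (Fin r) k, p.IsHomogeneous (i + 1) ∧
      u - aeval x p ∈ maximalIdeal A ^ i * piece A j 1 := by
  induction i with
  | zero =>
    intro u hu
    simpa using hx.span u (by simpa using hu)
  | succ i ih =>
    intro u hu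
    rw [pow_succ'] at hu
    refine Submodule.mul_induction_on hu (fun a ha b hb => ?_) fun a b ha hb => ?_
    · obtain ⟨p, hp, hpa⟩ := hx.span a ha
      obtain ⟨q, hq, hqb⟩ := ih b hb
      refine ⟨p * q, by simpa [add_comm] using hp.mul hq, ?_⟩
      have e : a * b - aeval x (p * q) =
          aeval x p * (b - aeval x q) + b * (a - aeval x p) := by
        rw [map_mul]
        ring
      rw [e]
      refine add_mem ?_ (Ideal.mul_mem_mul hb hpa)
      rw [pow_succ', mul_assoc]
      refine Ideal.mul_mem_mul ?_ hqb
      simpa using aeval_mem_pow_of_isHomogeneous hx.mem hp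
    · obtain ⟨p, hp, hpa⟩ := ha
      obtain ⟨q, hq, hqb⟩ := hb
      refine ⟨p + q, hp.add hq, ?_⟩
      rw [map_add, add_sub_add_comm]
      exact add_mem hpa hqb

theorem exists_aeval_sub_mem_piece (i : ℕ) (u : A) (hu : u ∈ maximalIdeal A ^ i) :
    ∃ p : MvPolynomial (Fin r) k, p.IsHomogeneous i ∧ u - aeval x p ∈ piece A j i := by
  cases i with
  | zero =>
    obtain ⟨c, hc⟩ := hx.residue u
    refine ⟨C c, isHomogeneous_C _ c, pow_le_piece hx.pow_eq_bot 0 ?_⟩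
    simpa [algebraMap_eq] using hc
  | succ i =>
    obtain ⟨p, hp, h⟩ := hx.exists_aeval_sub_mem_mul i u hu
    refine ⟨p, hp, Ideal.mul_le.2 (fun a ha b hb => ?_) h⟩
    rw [mul_comm, add_comm i]
    exact mul_mem_piece hb ha

/-- Elements of `𝔪^(j-d)` are values of forms of degree `j - d` up to an error in `piece A j (j -
d)`. That error kills `𝔪^d`, which contains `aeval x p`, so testing against forms is testing against
all of `𝔪^(j-d)`. -/
theorem mem_dualIdeal_iff {d : ℕ} {p : MvPolynomial (Fin r) k} (hp : p.IsHomogeneous d) :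
    p ∈ dualIdeal k j x ↔ aeval x p ∈ piece A j d := by
  have hpd := aeval_mem_pow_of_isHomogeneous hx.mem hp
  rw [mem_dualIdeal, mem_piece]
  constructor
  · refine fun h => ⟨hpd, fun v hv => ?_⟩
    rcases le_or_gt d j with hd | hd
    · obtain ⟨q, hq, hw⟩ := hx.exists_aeval_sub_mem_piece _ v hv
      have h1 := h q
      rw [topValue_mul hp, if_pos hd, homogeneousComponent_eq_self hq] at h1
      have h2 := (mem_piece.1 hw).2 _ (by rwa [Nat.sub_sub_self hd])
      rw [sub_mul, h1, sub_zero] at h2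
      rw [mul_comm, h2]
    · have : aeval x p = 0 := by
        rw [← Ideal.mem_bot, ← hx.pow_eq_bot]
        exact Ideal.pow_le_pow_right hd hpd
      rw [this, zero_mul]
  · rintro ⟨-, h⟩ q
    rw [topValue_mul hp]
    split_ifs with hd
    · rw [mul_comm]
      exact h _ (aeval_mem_pow_of_isHomogeneous hx.mem (homogeneousComponent_isHomogeneous _ q))
    · rfl

theorem gradedHilbertFunction_dualIdeal [Module.Finite k A] (hj : j = socleDegree A) (i : ℕ) :
    gradedHilbertFunction (dualIdeal k j x) i = symmetricDecomposition k A 0 i := by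
  subst hj
  obtain ⟨π, hπ, hker⟩ := exists_surjective_symmetricDecomposition_zero (k := k) (A := A) i
  let e : ↥(homogeneousSubmodule (Fin r) k i) →ₗ[k] ↥(maximalIdeal A ^ i) :=
    ((aeval x).toLinearMap.comp (Submodule.subtype _)).codRestrict
      ((maximalIdeal A ^ i).restrictScalars k)
      fun p => aeval_mem_pow_of_isHomogeneous hx.mem p.2
  have he (p : ↥(homogeneousSubmodule (Fin r) k i)) : (e p : A) = aeval x (p : MvPolynomial _ k) :=
    rfl
  have h := finrank_eq_of_ker_eq
    ((Ideal.Quotient.mkₐ k (dualIdeal k (socleDegree A) x)).toLinearMap.comp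
      (homogeneousSubmodule (Fin r) k i).subtype) (π.comp e) (by
      ext p
      rw [LinearMap.mem_ker, LinearMap.mem_ker, LinearMap.comp_apply, LinearMap.comp_apply, hker,
        he, ← hx.mem_dualIdeal_iff p.2]
      exact Ideal.Quotient.eq_zero_iff_mem)
  have hs : LinearMap.range (π.comp e) = ⊤ := by
    rw [LinearMap.range_eq_top]
    intro y
    obtain ⟨u, rfl⟩ := hπ y
    obtain ⟨p, hp, h⟩ := hx.exists_aeval_sub_mem_piece i u u.2
    refine ⟨⟨p, hp⟩, ?_⟩
    rw [LinearMap.comp_apply, ← sub_eq_zero, ← map_sub, ← neg_sub, map_neg, neg_eq_zero, hker]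
    exact h
  rw [hs, finrank_top, LinearMap.range_comp, Submodule.range_subtype] at h
  exact h

end IsCoordinateSystem

end LocalRing

end Coordinates

/-! ### Locality from an augmentation with nil kernel. -/

section Augmentation

variable {k B : Type*} [Field k] [CommRing B] [Algebra k B]

theorem isUnit_of_isNilpotent_sub {b : B} {c : k} (h : IsNilpotent (b - algebraMap k B c))
    (hc : c ≠ 0) : IsUnit b := by
  have := h.isUnit_add_left_of_commute ((IsUnit.mk0 c hc).map (algebraMap k B)) (Commute.all _ _)
  simpa using this

theorem isLocalRing_of_isNilpotent_sub (ε : B →ₐ[k] k)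
    (h : ∀ b, IsNilpotent (b - algebraMap k B (ε b))) : IsLocalRing B := by
  have : IsLocalHom (ε : B →+* k) := ⟨fun b hb => isUnit_of_isNilpotent_sub (h b) hb.ne_zero⟩
  exact RingHom.domain_isLocalRing (ε : B →+* k)

theorem mem_maximalIdeal_iff_of_isNilpotent_sub [IsLocalRing B] (ε : B →ₐ[k] k)
    (h : ∀ b, IsNilpotent (b - algebraMap k B (ε b))) (b : B) :
    b ∈ maximalIdeal B ↔ ε b = 0 := by
  rw [mem_maximalIdeal, mem_nonunits_iff]
  constructor
  · intro hb
    by_contra hc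
    exact hb (isUnit_of_isNilpotent_sub (h b) hc)
  · intro hb hu
    exact (hu.map ε).ne_zero hb

end Augmentation

/-! ### The quotient by the dual ideal is graded AG. -/

section Gorenstein

variable {k A : Type*} [Field k] [CommRing A] [Algebra k A] [IsLocalRing A] {r : ℕ}

namespace IsCoordinateSystem

variable {j : ℕ} {x : Fin r → A} (hx : IsCoordinateSystem k j x)

include hx

theorem exists_aeval_eq {u : A} (hu : u ∈ maximalIdeal A ^ j) :
    ∃ p : MvPolynomial (Fin r) k, p.IsHomogeneous j ∧ aeval x p = u := by
  obtain ⟨p, hp, h⟩ := hx.exists_aeval_sub_mem_piece j u hu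
  refine ⟨p, hp, (sub_eq_zero.1 ?_).symm⟩
  -- In degree `j` the error annihilates `𝔪^0 = A`, so it is zero.
  simpa using (mem_piece.1 h).2 1 (by simp)

theorem one_notMem_dualIdeal (hj : maximalIdeal A ^ j ≠ ⊥) : 1 ∉ dualIdeal k j x := by
  obtain ⟨u, hu, h0⟩ := Submodule.exists_mem_ne_zero_of_ne_bot hj
  obtain ⟨p, hp, rfl⟩ := hx.exists_aeval_eq hu
  intro h
  refine h0 ?_
  have := h p
  rwa [mul_one, topValue, LinearMap.comp_apply, homogeneousComponent_eq_self hp] at this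

theorem coeff_zero_of_mem_dualIdeal (hj : maximalIdeal A ^ j ≠ ⊥) {p : MvPolynomial (Fin r) k}
    (hp : p ∈ dualIdeal k j x) : coeff 0 p = 0 := by
  have h := homogeneousComponent_mem_dualIdeal hp 0
  rw [homogeneousComponent_zero] at h
  by_contra hc
  refine hx.one_notMem_dualIdeal hj ?_
  have := Ideal.mul_mem_left _ (C (coeff 0 p)⁻¹) h
  rwa [← C_mul, inv_mul_cancel₀ hc, C_1] at this

/-- The socle is spanned by the class of a degree-`j` form `p₀` with value `u`. A socle element is
determined by its top value, because the positive-degree part of any multiplier kills it. -/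
theorem isGradedAG_dualIdeal {u : A} (hu : u ∈ maximalIdeal A ^ j) (hu0 : u ≠ 0)
    (hspan : ∀ v ∈ maximalIdeal A ^ j, ∃ c : k, c • u = v) : IsGradedAG (dualIdeal k j x) := by
  have hj : maximalIdeal A ^ j ≠ ⊥ := fun h => hu0 (by simpa [h] using hu)
  let ε : (MvPolynomial (Fin r) k ⧸ dualIdeal k j x) →ₐ[k] k :=
    Ideal.Quotient.liftₐ _ (aeval (0 : Fin r → k)) fun p hp => by
      simpa [constantCoeff_eq] using hx.coeff_zero_of_mem_dualIdeal hj hp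
  have hε (p : MvPolynomial (Fin r) k) : ε (Ideal.Quotient.mk _ p) = coeff 0 p := by
    simp [ε, ← constantCoeff_eq]
  have hnil (b) : IsNilpotent (b - algebraMap k _ (ε b)) := by
    obtain ⟨p, rfl⟩ := Ideal.Quotient.mk_surjective b
    rw [hε]
    exact isNilpotent_mk_sub j x p
  have hloc := isLocalRing_of_isNilpotent_sub ε hnil
  have hmem := mem_maximalIdeal_iff_of_isNilpotent_sub ε hnil
  refine ⟨dualIdeal_isHomogeneous j x, hloc, finite_quotient_dualIdeal j x,
    ⟨(algebraMap k _).injective, fun b => ?_⟩, ?_⟩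
  · obtain ⟨b, rfl⟩ := residue_surjective b
    refine ⟨ε b, ?_⟩
    rw [IsScalarTower.algebraMap_apply k (MvPolynomial (Fin r) k ⧸ dualIdeal k j x),
      ResidueField.algebraMap_eq, eq_comm, ← sub_eq_zero, ← map_sub, residue_eq_zero_iff, hmem]
    simp
  · obtain ⟨p₀, hp₀, rfl⟩ := hx.exists_aeval_eq hu
    have htop : topValue k j x p₀ = aeval x p₀ := by
      rw [topValue, LinearMap.comp_apply, homogeneousComponent_eq_self hp₀]
      rfl
    have hsoc : Ideal.Quotient.mk (dualIdeal k j x) p₀ ∈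
        (maximalIdeal (MvPolynomial (Fin r) k ⧸ dualIdeal k j x)).annihilator := by
      rw [Submodule.mem_annihilator]
      intro b hb
      obtain ⟨q, rfl⟩ := Ideal.Quotient.mk_surjective b
      rw [hmem, hε] at hb
      rw [smul_eq_mul, mul_comm, ← map_mul, Ideal.Quotient.eq_zero_iff_mem]
      exact mul_mem_dualIdeal hp₀ hb
    rw [finrank_eq_one_iff']
    refine ⟨⟨_, hsoc⟩, fun h => hu0 ?_, ?_⟩
    · have h1 := Ideal.Quotient.eq_zero_iff_mem.1 (congrArg Subtype.val h)
      rw [← htop, ← one_mul p₀, h1 1]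
    · rintro ⟨w, hw⟩
      obtain ⟨p, rfl⟩ := Ideal.Quotient.mk_surjective w
      obtain ⟨c, hc⟩ := hspan (topValue k j x p)
        (aeval_mem_pow_of_isHomogeneous hx.mem (homogeneousComponent_isHomogeneous j p))
      refine ⟨c, Subtype.ext ?_⟩
      refine Ideal.Quotient.eq.2 fun q => ?_
      have hq : coeff 0 (q - C (coeff 0 q)) = 0 := by simp
      have h1 : (q - C (coeff 0 q)) * p ∈ dualIdeal k j x := by
        rw [← Ideal.Quotient.eq_zero_iff_mem, map_mul, mul_comm]
        exact Submodule.mem_annihilator.1 hw _ ((hmem _).2 (by rw [hε, hq]))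
      have h2 := mul_mem_dualIdeal (x := x) hp₀ hq
      -- Split `q` into its constant term and the rest: the rest sends `p₀` and `p` into the dual
      -- ideal, and `c` makes the top values of `c • p₀` and `p` agree.
      have e : q * (c • p₀ - p) = (c • (1 * ((q - C (coeff 0 q)) * p₀))
          - 1 * ((q - C (coeff 0 q)) * p)) + coeff 0 q • (c • p₀ - p) := by
        simp only [smul_eq_C_mul]
        ring
      refine (congrArg _ e).trans ?_
      rw [map_add, map_sub, map_smul, h1 1, h2 1, map_smul, map_sub, map_smul, htop, hc]
      simp

end IsCoordinateSystem

end Gorenstein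

/-! ### Existence of coordinates, and the socle degree read off from `H_A(0)`. -/

section Main

variable {k A : Type*} [Field k] [CommRing A] [Algebra k A] [IsLocalRing A]

theorem exists_isCoordinateSystem (hA : IsArtinianGorenstein k A) {r : ℕ}
    (hr : symmetricDecomposition k A 0 1 = r) :
    ∃ x : Fin r → A, IsCoordinateSystem k (socleDegree A) x := by
  have := hA.finite
  obtain ⟨π, hπ, hker⟩ := exists_surjective_symmetricDecomposition_zero (k := k) (A := A) 1
  have : Module.Finite k (↥(idealC A 0 1) ⧸ (idealC A (0 + 1) 1).submoduleOf (idealC A 0 1)) :=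
    have : Module.Finite k ↥(maximalIdeal A ^ 1) :=
      Module.Finite.of_injective ((maximalIdeal A ^ 1).subtype.restrictScalars k)
        Subtype.val_injective
    Module.Finite.of_surjective π hπ
  let b := Module.finBasisOfFinrankEq k _ hr
  choose y hy using fun i => hπ (b i)
  have hsum (c : Fin r → k) : aeval (fun i => (y i : A)) (∑ i, c i • (X i : MvPolynomial _ k)) =
      ((∑ i, c i • y i : ↥(maximalIdeal A ^ 1)) : A) := by
    simp
  have hπsum (c : Fin r → k) : π (∑ i, c i • y i) = ∑ i, c i • b i := by
    simp [hy]
  refine ⟨fun i => y i, (maximalIdeal_pow_eq_bot_iff (k := k) _).2 (Nat.lt_succ_self _),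
    fun a => ?_, fun i => by simpa using (y i).2, fun u hu => ?_, fun p hp h => ?_⟩
  · obtain ⟨c, hc⟩ := hA.residue.2 (residue A a)
    refine ⟨c, ?_⟩
    rw [← residue_eq_zero_iff, map_sub, ← hc, sub_eq_zero]
    rfl
  · let u' : ↥(maximalIdeal A ^ 1) := ⟨u, by simpa using hu⟩
    refine ⟨∑ i, b.repr (π u') i • X i, Submodule.sum_mem (homogeneousSubmodule _ _ _)
      fun i _ => Submodule.smul_mem _ _ (isHomogeneous_X k i), ?_⟩
    rw [hsum]
    refine (hker (u' - ∑ i, b.repr (π u') i • y i)).1 ?_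
    rw [map_sub, hπsum, b.sum_repr, sub_self]
  · rw [← mem_homogeneousSubmodule, homogeneousSubmodule_one_eq_span_X,
      Submodule.mem_span_range_iff_exists_fun] at hp
    obtain ⟨c, rfl⟩ := hp
    rw [hsum, ← hker, hπsum] at h
    have hc := Fintype.linearIndependent_iff.1 b.linearIndependent c h
    simp [hc]

theorem exists_span_pow_socleDegree (hA : IsArtinianGorenstein k A) :
    ∃ u ∈ maximalIdeal A ^ socleDegree A, u ≠ 0 ∧
      ∀ v ∈ maximalIdeal A ^ socleDegree A, ∃ c : k, c • u = v := by
  have := hA.finite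
  have hle : maximalIdeal A ^ socleDegree A ≤ (maximalIdeal A).annihilator := fun u hu => by
    refine Submodule.mem_annihilator.2 fun v hv => ?_
    rw [smul_eq_mul, ← Ideal.mem_bot,
      ← (maximalIdeal_pow_eq_bot_iff (k := k) (A := A) _).2 (Nat.lt_succ_self _), pow_succ]
    exact Ideal.mul_mem_mul hu hv
  obtain ⟨u, hu, hu0⟩ := Submodule.exists_mem_ne_zero_of_ne_bot
    fun h => lt_irrefl _ ((maximalIdeal_pow_eq_bot_iff (k := k) (A := A) _).1 h)
  refine ⟨u, hu, hu0, fun v hv => ?_⟩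
  obtain ⟨c, hc⟩ := (finrank_eq_one_iff_of_nonzero' (⟨u, hle hu⟩ : ↥(maximalIdeal A).annihilator)
    (fun h => hu0 (congrArg Subtype.val h))).1 hA.socle ⟨v, hle hv⟩
  exact ⟨c, congrArg Subtype.val hc⟩

theorem socleDegree_eq [Module.Finite k A] {H : ℕ → ℕ} {j : ℕ} (htop : H j ≠ 0)
    (hzero : ∀ i, j < i → H i = 0) (h : ∀ i, symmetricDecomposition k A 0 i = H i) :
    socleDegree A = j := by
  refine le_antisymm ?_ ?_
  · by_contra! hlt
    have h0 := hzero _ hlt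
    rw [← h, symmetricDecomposition_eq_zero_iff] at h0
    refine lt_irrefl _ ((maximalIdeal_pow_eq_bot_iff (k := k) (A := A) (socleDegree A)).1 ?_)
    have hs := (maximalIdeal_pow_eq_bot_iff (k := k) (A := A) _).2
      (Nat.lt_succ_self (socleDegree A))
    rw [hs, sup_bot_eq, Nat.sub_zero, Nat.sub_zero] at h0
    rw [eq_bot_iff]
    intro u hu
    have := h0 (mem_piece.2 ⟨hu, fun v hv => by
      rw [← Ideal.mem_bot, ← hs, pow_succ]
      exact Ideal.mul_mem_mul hu (by simpa using hv)⟩)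
    simpa using (mem_piece.1 this).2 1 (by simp)
  · by_contra! hlt
    refine htop ?_
    rw [← h, symmetricDecomposition_eq_zero_iff]
    refine inf_le_left.trans ?_
    rw [(maximalIdeal_pow_eq_bot_iff (k := k) (A := A) j).2 hlt]
    exact bot_le

end Main

/-! ### Consequences of bounded generator degrees. -/

namespace IsCoordinateSystem

variable {k A : Type*} [Field k] [CommRing A] [Algebra k A] [IsLocalRing A] {r : ℕ}
  {j : ℕ} {x : Fin r → A} (hx : IsCoordinateSystem k j x)

include hx

theorem eq_zero_of_isGeneratedInDegreesLE_one (hj : maximalIdeal A ^ j ≠ ⊥)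
    (h : IsGeneratedInDegreesLE (dualIdeal k j x) 1) : j = 0 := by
  have hI : dualIdeal k j x = ⊥ := by
    rw [h, Ideal.span_eq_bot]
    rintro p ⟨hp, d, hd, hpd⟩
    obtain rfl | rfl : d = 0 ∨ d = 1 := by omega
    · have h0 := hx.coeff_zero_of_mem_dualIdeal hj hp
      rw [← homogeneousComponent_eq_self hpd, homogeneousComponent_zero, h0, C_0]
    · exact hx.indep p hpd ((hx.mem_dualIdeal_iff hpd).1 hp)
  -- A variable would have its `(j+1)`-st power in the zero ideal.
  have hr : IsEmpty (Fin r) := ⟨fun i => by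
    have := mem_dualIdeal_of_lt (x := x) (isHomogeneous_X_pow (R := k) i (j + 1))
      (Nat.lt_succ_self j)
    rw [hI, Ideal.mem_bot] at this
    exact X_ne_zero i (pow_eq_zero_iff (Nat.succ_ne_zero j) |>.1 this)⟩
  by_contra hj0
  refine hj (eq_bot_iff.2 ?_)
  obtain ⟨i, rfl⟩ := Nat.exists_eq_succ_of_ne_zero hj0
  rw [pow_succ', Ideal.mul_le]
  intro u hu v hv
  obtain ⟨p, hp, hup⟩ := hx.span u hu
  have hp0 : p = 0 := by
    by_contra hp0
    exact one_ne_zero (hp.inj_right (isHomogeneous_of_isEmpty _ _ p) hp0)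
  rw [hp0, map_zero, sub_zero] at hup
  exact (mem_piece.1 hup).2 v (by simpa using hv)

/-- In degree `m + 1` every generator, of degree `d ≤ m`, carries a cofactor of degree `m + 1 - d ≥
1`, from which one factor `𝔪` splits off. -/
theorem aeval_homogeneousComponent_mem {m : ℕ}
    (h : IsGeneratedInDegreesLE (dualIdeal k j x) m) {p : MvPolynomial (Fin r) k}
    (hp : p ∈ dualIdeal k j x) :
    aeval x (homogeneousComponent (m + 1) p) ∈ maximalIdeal A * piece A j m := by
  rw [h] at hp
  -- The free multiplier `q` makes the span induction pass through scalar multiplication.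
  suffices H : ∀ q, aeval x (homogeneousComponent (m + 1) (q * p)) ∈
      maximalIdeal A * piece A j m by simpa using H 1
  refine Submodule.span_induction (fun g hg q => ?_) (by simp) (fun f g _ _ hf hg q => ?_)
    (fun a g _ hg q => ?_) hp
  · obtain ⟨hgI, d, hd, hgd⟩ := hg
    have hdm : d ≤ m := by exact_mod_cast hd
    rw [homogeneousComponent_mul_of_isHomogeneous hgd, if_pos (by omega), map_mul,
      Nat.sub_add_comm hdm]
    refine (?_ : maximalIdeal A ^ (m - d + 1) * piece A j d ≤ _) (Ideal.mul_mem_mul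
      (aeval_mem_pow_of_isHomogeneous hx.mem (homogeneousComponent_isHomogeneous _ q))
      ((hx.mem_dualIdeal_iff hgd).1 hgI))
    rw [pow_succ', mul_assoc]
    refine Ideal.mul_mono_right (Ideal.mul_le.2 fun a ha b hb => ?_)
    have := mul_mem_piece hb ha
    rwa [mul_comm, Nat.add_sub_cancel' hdm] at this
  · rw [mul_add, map_add, map_add]
    exact add_mem (hf q) (hg q)
  · rw [smul_eq_mul, ← mul_assoc]
    exact hg (q * a)

theorem piece_le_mul_piece {m : ℕ} (hm : 0 < m)
    (h : IsGeneratedInDegreesLE (dualIdeal k j x) m) :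
    piece A j (m + 1) ≤ maximalIdeal A * piece A j m := by
  intro u hu
  obtain ⟨p, hp, hw⟩ := hx.exists_aeval_sub_mem_mul m u (mem_piece.1 hu).1
  -- As `m > 0`, one factor `𝔪` is kept aside and the other `m - 1` raise `piece A j 1` to `piece A
  -- j m`.
  have hle : maximalIdeal A ^ m * piece A j 1 ≤ maximalIdeal A * piece A j m := by
    obtain ⟨i, rfl⟩ := Nat.exists_eq_succ_of_ne_zero hm.ne'
    rw [pow_succ', mul_assoc]
    refine Ideal.mul_mono_right (Ideal.mul_le.2 fun a ha b hb => ?_)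
    rw [mul_comm, ← Nat.add_one, add_comm i]
    exact mul_mem_piece hb ha
  have hle' : maximalIdeal A * piece A j m ≤ piece A j (m + 1) :=
    Ideal.mul_le.2 fun a ha b hb => by
      rw [mul_comm]
      exact mul_mem_piece hb (by simpa using ha)
  have hpx : p ∈ dualIdeal k j x := by
    rw [hx.mem_dualIdeal_iff hp, ← sub_sub_cancel u (aeval x p)]
    exact sub_mem hu (hle' (hle hw))
  have := hx.aeval_homogeneousComponent_mem h hpx
  rw [homogeneousComponent_eq_self hp] at this
  rw [← sub_add_cancel u (aeval x p)]
  exact add_mem (hle hw) this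

end IsCoordinateSystem

theorem IsGeneratedInDegreesLE.mono {k : Type*} [Field k] {r : ℕ}
    {I : Ideal (MvPolynomial (Fin r) k)} {c d : ℤ} (h : IsGeneratedInDegreesLE I c) (hcd : c ≤ d) :
    IsGeneratedInDegreesLE I d := by
  refine le_antisymm ?_ (Ideal.span_le.2 fun p hp => hp.1)
  conv_lhs => rw [h]
  exact Ideal.span_mono fun p ⟨hp, e, he, hpe⟩ => ⟨hp, e, he.trans hcd, hpe⟩

theorem symmetricDecomposition_one_ne_spikes {k A : Type*} [Field k] [CommRing A] [Algebra k A]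
    [IsLocalRing A] (hA : IsArtinianGorenstein k A) {H : ℕ → ℕ} {j : ℕ} (htop : H j ≠ 0)
    (hzero : ∀ i, j < i → H i = 0)
    (hgen : ∀ I : Ideal (MvPolynomial (Fin (H 1)) k), IsGradedAG I →
      (∀ i, gradedHilbertFunction I i = H i) → IsGeneratedInDegreesLE I ((j : ℤ) - 3))
    (h₀ : ∀ i, symmetricDecomposition k A 0 i = H i) :
    ¬ ∀ i, symmetricDecomposition k A 1 i = spikes j i := by
  intro h₁
  have := hA.finite
  have hj := socleDegree_eq htop hzero h₀
  obtain ⟨x, hx⟩ := exists_isCoordinateSystem hA (h₀ 1)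
  obtain ⟨u, hu, hu0, hspan⟩ := exists_span_pow_socleDegree hA
  rw [hj] at hx hu hspan
  have hI := hgen _ (hx.isGradedAG_dualIdeal hu hu0 hspan) fun i => by
    rw [hx.gradedHilbertFunction_dualIdeal hj.symm, h₀]
  have hj1 : maximalIdeal A ^ j ≠ ⊥ := fun h => hu0 (by simpa [h] using hu)
  -- For `j = 4` the degree `j - 3 = 1` carries a spike itself, so the vanishing of `H(1)_{j-3}` is
  -- available only from `j = 5` on.
  rcases le_or_gt j 4 with h4 | h4
  · have hj0 := hx.eq_zero_of_isGeneratedInDegreesLE_one hj1 (hI.mono (by omega))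
    have h : symmetricDecomposition k A 1 1 = 0 := by
      rw [symmetricDecomposition_eq_zero_iff]
      refine inf_le_left.trans ?_
      rw [(maximalIdeal_pow_eq_bot_iff (k := k) (A := A) 1).2 (by omega)]
      exact bot_le
    simp [h₁, spikes] at h
  · obtain ⟨m, rfl⟩ : ∃ m, j = m + 3 := ⟨j - 3, by omega⟩
    have hm : symmetricDecomposition k A 1 m = 0 := by
      rw [h₁, spikes, if_neg (by omega)]
    have hm1 : symmetricDecomposition k A 1 (m + 1) ≠ 0 := by
      rw [h₁, spikes, if_pos (by omega)]
      exact one_ne_zero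
    rw [symmetricDecomposition_eq_zero_iff, hj] at hm
    rw [Ne, symmetricDecomposition_eq_zero_iff, hj] at hm1
    refine hm1 ((hx.piece_le_mul_piece (by omega) (hI.mono (by simp))).trans
      ((Ideal.mul_mono_right hm).trans ?_))
    rw [Ideal.mul_sup, ← pow_succ']
    refine sup_le_sup_right (Ideal.mul_le.2 fun a ha b hb => ?_) _
    rw [mul_comm]
    exact mul_mem_piece hb (by simpa using ha)

end SymDecomp

theorem mainTheorem6 {k : Type*} [Field k] [Infinite k] (H₀ : ℕ → ℕ) (j : ℕ)
    (hH₀ : SymDecomp.IsSymmetricGorensteinSequence k H₀ j)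
    (hgen : ∀ I : Ideal (MvPolynomial (Fin (H₀ 1)) k), SymDecomp.IsGradedAG I →
      (∀ i, SymDecomp.gradedHilbertFunction I i = H₀ i) →
      SymDecomp.IsGeneratedInDegreesLE I ((j : ℤ) - 3)) :
    ¬ SymDecomp.IsRealizable k (SymDecomp.pair H₀ (SymDecomp.spikes j)) ∧
      ∀ D : ℕ → ℕ → ℕ, SymDecomp.IsRealizable k D →
        ¬ (D 0 = H₀ ∧ D 1 = SymDecomp.spikes j) := by
  have key (D : ℕ → ℕ → ℕ) (hD : SymDecomp.IsRealizable k D) :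
      ¬ (D 0 = H₀ ∧ D 1 = SymDecomp.spikes j) := by
    rintro ⟨h0, h1⟩
    obtain ⟨n, I, hloc, hA, h⟩ := hD
    exact SymDecomp.symmetricDecomposition_one_ne_spikes hA hH₀.top_ne_zero hH₀.eq_zero_of_lt hgen
      (fun i => by rw [h, h0]) fun i => by rw [h, h1]
  exact ⟨fun h => key _ h ⟨rfl, rfl⟩, key⟩
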